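/- Let $n\ge 1$, $\mathcal N=\{1,\dots,n\}$, and let $\mu>0$, $0<d_0<d_1$ and $0<\delta_{\min}<\delta_{\max}$ be real numbers. For every robot $i\in\mathcal N$ let $(t^i_k)_{k\in\mathbb N}$ be its sequence of wake-up times, with $0\le t_0^i\le\delta_{\max}$ and $t^i_{k+1}-t^i_k\in[\delta_{\min},\delta_{\max}]$ for all $k\in\mathbb N$. The robots move in the plane with positions $x_i(t)\in\mathbb R^2$, $t\ge 0$, and $\|\cdot\|$ is the Euclidean norm. Let $\mathrm{sat}(v)=\mu v/\|v\|$ if $\|v\|\ge\mu$ and $\mathrm{sat}(v)=v$ otherwise. For $i,j\in\mathcal N$ and $t\ge 0$ let $b_{ij}(t)=1$ if at least one of the following two conditions holds, and $b_{ij}(t)=0$ otherwise: - ($i$ engages) there is $k\in\mathbb N$ with $t\in[t^i_k,t^i_k+\delta_{\min}]$ and $\|x_i(t^i_k)-x_j(t^i_k)\|\ge d_1$; - ($i$ reciprocates) there is $h\in\mathbb N$ with $t\in[t^i_h,t^i_h+\delta_{\min}]$ and $\|x_i(t)-x_j(t)\|\ge d_0$, and there is $k\in\mathbb N$ with $t^j_k\in[t^i_h-\delta_{\max},t^i_h]$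 and $\|x_i(t^j_k)-x_j(t^j_k)\|\ge d_1$. Let $x=(x_1,\dots,x_n)$ be a (Carathéodory) solution on $[0,\infty)$ of $$\dot x_i(t)=\mathrm{sat}\Big(\sum_{j\in\mathcal N}b_{ij}(t)\,(x_j(t)-x_i(t))\Big),\qquad i\in\mathcal N,$$ that is, the right-hand sides are locally integrable and each $x_i$ is $x_i(0)$ plus the integral of the right-hand side from $0$ to $t$. Assume that $4\,\delta_{\max}\,\mu\le d_1-d_0$. Then $x_i^*=\lim_{t\to\infty}x_i(t)$ exists for every $i\in\mathcal N$, and, with $\Delta(t)=\max_{i,j\in\mathcal N}\|x_i(t)-x_j(t)\|$, the limit $\lim_{t\to\infty}\Delta(t)$ exists and is at most $d_1$. -/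

import Mathlib

open MeasureTheory Filter Topology

noncomputable section

namespace MobileRobots

/-- The plane `ℝ²` with its Euclidean norm. -/
abbrev Plane : Type := EuclideanSpace ℝ (Fin 2)

/-- Saturation at level `μ`: vectors of norm at least `μ` are rescaled to norm `μ`. -/
def sat (μ : ℝ) (v : Plane) : Plane :=
  if μ ≤ ‖v‖ then (μ / ‖v‖) • v else v

/-- Admissible wake-up times: robot `i` wakes up at the nonnegative times `τ i 0, τ i 1, …`;
the first one is at most `δmax`, consecutive ones are between `δmin` and `δmax` apart. -/
structure IsWakeUpSchedule {n : ℕ} (δmin δmax : ℝ) (τ : Fin n → ℕ → ℝ) : Prop where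
  zero_le : ∀ i, 0 ≤ τ i 0
  first_le : ∀ i, τ i 0 ≤ δmax
  gap_mem : ∀ i k, τ i (k + 1) - τ i k ∈ Set.Icc δmin δmax

/-- Robot `i` engages with robot `j` at time `t`: it is in a monitoring period at the beginning of
which the two robots were at distance at least `d₁`. -/
def Engages {n : ℕ} (d₁ δmin : ℝ) (τ : Fin n → ℕ → ℝ) (x : Fin n → ℝ → Plane)
    (i j : Fin n) (t : ℝ) : Prop :=
  ∃ k : ℕ, t ∈ Set.Icc (τ i k) (τ i k + δmin) ∧ d₁ ≤ ‖x i (τ i k) - x j (τ i k)‖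

/-- Robot `i` reciprocates towards robot `j` at time `t`: it is in a monitoring period, the two
robots are at distance at least `d₀`, and at some wake-up time of `j` during the last `δmax` time
units before the beginning of this period the two robots were at distance at least `d₁`
(so that `j` engaged with `i`). -/
def Reciprocates {n : ℕ} (d₀ d₁ δmin δmax : ℝ) (τ : Fin n → ℕ → ℝ) (x : Fin n → ℝ → Plane)
    (i j : Fin n) (t : ℝ) : Prop :=
  ∃ h : ℕ, t ∈ Set.Icc (τ i h) (τ i h + δmin) ∧ d₀ ≤ ‖x i t - x j t‖ ∧
    ∃ k : ℕ, τ j k ∈ Set.Icc (τ i h - δmax) (τ i h) ∧ d₁ ≤ ‖x i (τ j k) - x j (τ j k)‖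

open Classical in
/-- The weight `b i j t`: it is `1` if `i` engages with `j` or reciprocates towards `j` at time `t`,
and `0` otherwise. -/
def weight {n : ℕ} (d₀ d₁ δmin δmax : ℝ) (τ : Fin n → ℕ → ℝ) (x : Fin n → ℝ → Plane)
    (i j : Fin n) (t : ℝ) : ℝ :=
  if Engages d₁ δmin τ x i j t ∨ Reciprocates d₀ d₁ δmin δmax τ x i j t then 1 else 0

/-- The velocity prescribed to robot `i` at time `t`. -/
def velocity {n : ℕ} (μ d₀ d₁ δmin δmax : ℝ) (τ : Fin n → ℕ → ℝ) (x : Fin n → ℝ → Plane)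
    (i : Fin n) (t : ℝ) : Plane :=
  sat μ (∑ j, weight d₀ d₁ δmin δmax τ x i j t • (x j t - x i t))

/-- `x` is a (Carathéodory) trajectory on `[0, ∞)` of the saturated consensus system: the prescribed
velocities are locally integrable and every `x i` is the integral of its velocity. -/
def IsTrajectory {n : ℕ} (μ d₀ d₁ δmin δmax : ℝ) (τ : Fin n → ℕ → ℝ)
    (x : Fin n → ℝ → Plane) : Prop :=
  ∀ i, ∀ t : ℝ, 0 ≤ t →
    IntervalIntegrable (velocity μ d₀ d₁ δmin δmax τ x i) volume 0 t ∧
    x i t = x i 0 + ∫ s in (0 : ℝ)..t, velocity μ d₀ d₁ δmin δmax τ x i s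

/-- The group diameter `max_{i,j} ‖x i t - x j t‖`. -/
def groupDiam {n : ℕ} [NeZero n] (x : Fin n → ℝ → Plane) (t : ℝ) : ℝ :=
  (Finset.univ : Finset (Fin n × Fin n)).sup' Finset.univ_nonempty
    (fun p => ‖x p.1 t - x p.2 t‖)

end MobileRobots

end

/-!
Saturation only rescales the input of a robot, so each coordinate of a trajectory obeys linear
consensus dynamics whose weights are bounded below while they are active, because the trajectory is
bounded. The condition on `δmax * μ` guarantees that a robot found at distance `d₁` is still at
distance `d₀` when its turn comes to reciprocate: the attraction is mutual up to a delay.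

Suppose that two robots engage infinitely often. In the graph of pairs that engage infinitely often,
their component is eventually not influenced from outside. The gap which some agent has below the
maximum of its component shrinks at most exponentially along the flow and is passed on, up to a
constant factor, to a further agent by each engagement across the boundary of the set already
reached. Between such engagements this set is isolated and keeps its gap, so waiting for the next
one costs nothing, however long it takes. Hence the spread of every component tends to `0`, and with
it the distance of the two robots, which contradicts their being at distance at least `d₁` at
arbitrarily late engagements. So engagements cease, and then all robots stop.
-/

namespace MobileRobots

open Set

theorem gronwallBound_le_of_integral_le {p : ℝ → ℝ} {K ε a b : ℝ}
    (hp : ContinuousOn p (Icc a b))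
    (h : ∀ s ∈ Icc a b, ∀ t ∈ Icc s b, ∫ u in s..t, (K * p u + ε) ≤ p t - p s) :
    ∀ t ∈ Icc a b, gronwallBound (p a) K ε (t - a) ≤ p t := by
  set g : ℝ → ℝ := fun t => K * p t + ε with hg
  have hgc : ContinuousOn g (Icc a b) := (hp.const_smul K).add continuousOn_const
  have hslope : ∀ s ∈ Ico a b, ∀ r, -g s < r →
      ∃ᶠ t in 𝓝[>] s, (t - s)⁻¹ * (-p t - -p s) < r := by
    intro s hs r hr
    have hcs : ContinuousOn g (Ioo s b) :=
      hgc.mono ((Ioo_subset_Ioo_left hs.1).trans Ioo_subset_Icc_self)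
    have hderiv : HasDerivWithinAt (fun t => ∫ u in s..t, g u) (g s) (Ici s) s := by
      refine intervalIntegral.integral_hasDerivWithinAt_right (t := Ioi s)
        IntervalIntegrable.refl ?_ ?_
      · rw [← nhdsWithin_Ioo_eq_nhdsGT hs.2]
        exact hcs.stronglyMeasurableAtFilter_nhdsWithin measurableSet_Ioo s
      · rw [← continuousWithinAt_Ioo_iff_Ioi hs.2]
        exact (hgc s ⟨hs.1, hs.2.le⟩).mono ((Ioo_subset_Ioo_left hs.1).trans Ioo_subset_Icc_self)
    have hint := hderiv.neg.liminf_right_slope_le hr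
    refine (hint.and_eventually (Ioo_mem_nhdsGT hs.2)).mono fun t ⟨hlt, ht⟩ => ?_
    refine lt_of_le_of_lt ?_ hlt
    have := h s ⟨hs.1, hs.2.le⟩ t ⟨ht.1.le, ht.2.le⟩
    rw [slope_def_field, div_eq_inv_mul]
    refine mul_le_mul_of_nonneg_left ?_ (inv_nonneg.2 (sub_nonneg.2 ht.1.le))
    simp only [Pi.neg_apply, intervalIntegral.integral_same]
    linarith
  intro t ht
  have hneg : gronwallBound (-p a) K (-ε) (t - a) = -gronwallBound (p a) K ε (t - a) := by
    unfold gronwallBound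
    split_ifs <;> ring
  have := le_gronwallBound_of_liminf_deriv_right_le hp.neg hslope le_rfl
    (K := K) (ε := -ε) (fun s _ => by simp only [hg, Pi.neg_apply]; linarith) t ht
  simp only [Pi.neg_apply, hneg] at this
  linarith

theorem exists_finset_closed_connected {ι : Type*} [Finite ι] {R : ι → ι → Prop}
    (hR : ∀ i j, R i j → R j i) (i : ι) :
    ∃ C : Finset ι, i ∈ C ∧ (∀ j ∈ C, ∀ k ∉ C, ¬ R j k) ∧
      ∀ S ⊂ C, S.Nonempty → ∃ j ∈ S, ∃ k ∈ C, k ∉ S ∧ R j k := by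
  have hmem : ∀ j, j ∈ (toFinite {j | Relation.ReflTransGen R i j}).toFinset ↔
      Relation.ReflTransGen R i j := fun j => Finite.mem_toFinset _
  refine ⟨(toFinite {j | Relation.ReflTransGen R i j}).toFinset, (hmem i).2 .refl,
    fun j hj k hk hjk => hk ((hmem k).2 (((hmem j).1 hj).tail hjk)), ?_⟩
  rintro S hS ⟨j, hj⟩
  by_contra! hno
  refine hS.not_subset fun k hk => ?_
  have : Std.Symm R := ⟨hR⟩
  have hij : Relation.ReflTransGen R i j := (hmem j).1 (hS.subset hj)
  have hjk : Relation.ReflTransGen R j k :=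
    (Std.Symm.symm i j hij).trans ((hmem k).1 hk)
  clear hk
  induction hjk with
  | refl => exact hj
  | @tail l m _ hlm hl =>
    by_contra hm
    exact hno l hl m ((hmem m).2 (((hmem l).1 (hS.subset hl)).tail hlm)) hm hlm

theorem norm_le_sum_abs {ι : Type*} [Fintype ι] (v : EuclideanSpace ℝ ι) : ‖v‖ ≤ ∑ k, |v k| := by
  classical
  calc ‖v‖ = ‖∑ k, v k • EuclideanSpace.basisFun ι ℝ k‖ := by
        conv_lhs => rw [← (EuclideanSpace.basisFun ι ℝ).sum_repr v]
        simp
    _ ≤ ∑ k, ‖v k • EuclideanSpace.basisFun ι ℝ k‖ := norm_sum_le _ _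
    _ = ∑ k, |v k| := by simp [norm_smul]

theorem exists_forall_Ico_lt {ι : Type*} {S : Finset ι} {f : ι → ℝ → ℝ} {M t t' : ℝ}
    (hf : ∀ i ∈ S, ContinuousWithinAt (f i) (Ici t) t) (h : ∀ i ∈ S, f i t < M) (htt' : t < t') :
    ∃ v ∈ Ioc t t', ∀ u ∈ Ico t v, ∀ i ∈ S, f i u < M := by
  have hev : ∀ᶠ u in 𝓝[≥] t, ∀ i ∈ S, f i u < M :=
    (Finset.eventually_all S).2 fun i hi => (hf i hi).eventually_lt_const (h i hi)
  obtain ⟨v, hv, hvM⟩ := (mem_nhdsGE_iff_exists_mem_Ioc_Ico_subset htt').1 hev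
  exact ⟨v, hv, fun u hu => hvM hu⟩

section Consensus

variable {ι : Type*} {a : ι → ι → ℝ → ℝ} {y : ι → ℝ → ℝ}

/-- The agents in `S` are not influenced by agents outside `S` at the times in `I`. -/
def IsIsolatedOn (a : ι → ι → ℝ → ℝ) (S : Finset ι) (I : Set ℝ) : Prop :=
  ∀ t ∈ I, ∀ i ∈ S, ∀ j ∉ S, a i j t = 0

theorem IsIsolatedOn.mono {S : Finset ι} {I J : Set ℝ} (h : IsIsolatedOn a S J) (hIJ : I ⊆ J) :
    IsIsolatedOn a S I :=
  fun t ht => h t (hIJ ht)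

theorem IsIsolatedOn.mem_of_ne_zero {S : Finset ι} {I : Set ℝ} (h : IsIsolatedOn a S I)
    {t : ℝ} (ht : t ∈ I) {i j : ι} (hi : i ∈ S) (hij : a i j t ≠ 0) : j ∈ S :=
  not_imp_comm.1 (h t ht i hi j) hij

variable [Fintype ι]

theorem isIsolatedOn_univ (I : Set ℝ) : IsIsolatedOn a Finset.univ I :=
  fun _ _ _ _ j hj => absurd (Finset.mem_univ j) hj

/-- Real-valued consensus dynamics `y i' = ∑ j, a i j (y j - y i)` on `[0, ∞)`, in integral form,
with weights in `[0, 1]`. A robot trajectory is studied through its coordinates, which are flows of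
this kind. -/
structure IsConsensusFlow (a : ι → ι → ℝ → ℝ) (y : ι → ℝ → ℝ) : Prop where
  nonneg : ∀ i j t, 0 ≤ a i j t
  le_one : ∀ i j t, a i j t ≤ 1
  integrable : ∀ i s t, 0 ≤ s → s ≤ t →
    IntervalIntegrable (fun u => ∑ j, a i j u * (y j u - y i u)) volume s t
  sub_eq : ∀ i s t, 0 ≤ s → s ≤ t →
    y i t - y i s = ∫ u in s..t, ∑ j, a i j u * (y j u - y i u)

/-- The gap that an agent starting at an upper bound `M` opens below `M` within a duration `δ` when
it is pulled with weight `α` by an agent staying at distance `1` below `M`, while the other agents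
of `ι` pull it towards `M`. -/
noncomputable def pullGain (ι : Type*) [Fintype ι] (α δ : ℝ) : ℝ :=
  α / Fintype.card ι * (1 - Real.exp (-Fintype.card ι * δ))

theorem pullGain_pos [Nonempty ι] {α δ : ℝ} (hα : 0 < α) (hδ : 0 < δ) : 0 < pullGain ι α δ := by
  have hcard : (0 : ℝ) < Fintype.card ι := Nat.cast_pos.2 Fintype.card_pos
  have hexp : Real.exp (-Fintype.card ι * δ) < 1 := by
    rw [Real.exp_lt_one_iff, neg_mul, neg_lt_zero]
    positivity
  exact mul_pos (div_pos hα hcard) (sub_pos.2 hexp)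

namespace IsConsensusFlow

theorem continuousOn (hy : IsConsensusFlow a y) (i : ι) : ContinuousOn (y i) (Ici 0) := by
  intro t ht
  have ht0 : 0 ≤ t + 1 := add_nonneg ht zero_le_one
  have hprim := intervalIntegral.continuousOn_primitive_interval'
    (hy.integrable i 0 _ le_rfl ht0) left_mem_uIcc
  rw [uIcc_of_le ht0] at hprim
  have hcont := (continuousOn_const.add hprim).congr fun u hu =>
    sub_eq_iff_eq_add'.1 (hy.sub_eq i 0 u le_rfl hu.1)
  exact (hcont t ⟨ht, (lt_add_one t).le⟩).mono_of_mem_nhdsWithin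
    (inter_mem_nhdsWithin _ (Iic_mem_nhds (lt_add_one t)))

theorem neg (hy : IsConsensusFlow a y) : IsConsensusFlow a (fun i t => -y i t) := by
  have hsum : ∀ i, (fun u => ∑ j, a i j u * (-y j u - -y i u)) =
      fun u => -∑ j, a i j u * (y j u - y i u) := fun i => by
    funext u
    rw [← Finset.sum_neg_distrib]
    exact Finset.sum_congr rfl fun j _ => by ring
  refine ⟨hy.nonneg, hy.le_one, fun i s t hs hst => ?_, fun i s t hs hst => ?_⟩
  · rw [hsum]
    exact (hy.integrable i s t hs hst).neg
  · rw [hsum, intervalIntegral.integral_neg, ← hy.sub_eq i s t hs hst]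
    ring

theorem gronwallBound_le_gap (hy : IsConsensusFlow a y) {s b M K r : ℝ} (hs : 0 ≤ s) {i : ι}
    (h : ∀ t ∈ Ico s b, ∑ j, a i j t * (y j t - y i t) ≤ K * (M - y i t) - r) :
    ∀ t ∈ Icc s b, gronwallBound (M - y i s) (-K) r (t - s) ≤ M - y i t := by
  have hcont : ContinuousOn (y i) (Icc s b) :=
    (hy.continuousOn i).mono fun t ht => hs.trans ht.1
  refine gronwallBound_le_of_integral_le (continuousOn_const.sub hcont) fun u hu t ht => ?_
  have hu0 : 0 ≤ u := hs.trans hu.1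
  have hsub : Icc u t ⊆ Icc s b := Icc_subset_Icc hu.1 ht.2
  have hint : IntervalIntegrable (fun v => -K * (M - y i v) + r) volume u t :=
    ContinuousOn.intervalIntegrable_of_Icc ht.1 <|
      ((continuousOn_const.sub (hcont.mono hsub)).const_smul (-K)).add continuousOn_const
  calc ∫ v in u..t, (-K * (M - y i v) + r)
      ≤ ∫ v in u..t, -∑ j, a i j v * (y j v - y i v) := by
        refine intervalIntegral.integral_mono_on_of_le_Ioo ht.1 hint
          (hy.integrable i u t hu0 ht.1).neg fun v hv => ?_
        linarith [h v ⟨hu.1.trans hv.1.le, hv.2.trans_le ht.2⟩]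
    _ = M - y i t - (M - y i u) := by
        rw [intervalIntegral.integral_neg, ← hy.sub_eq i u t hu0 ht.1]
        ring

theorem gap_mul_exp_le (hy : IsConsensusFlow a y) {s b M : ℝ} (hs : 0 ≤ s) {i : ι}
    (hi : ∀ t ∈ Ico s b, y i t ≤ M) (h : ∀ t ∈ Ico s b, ∀ j, a i j t ≠ 0 → y j t ≤ M) :
    ∀ t ∈ Icc s b, (M - y i s) * Real.exp (-Fintype.card ι * (t - s)) ≤ M - y i t := by
  simp only [← gronwallBound_ε0]
  refine hy.gronwallBound_le_gap hs fun t ht => ?_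
  calc ∑ j, a i j t * (y j t - y i t) ≤ ∑ _j : ι, (M - y i t) := by
        refine Finset.sum_le_sum fun j _ => ?_
        by_cases hij : a i j t = 0
        · rw [hij, zero_mul]
          exact sub_nonneg.2 (hi t ht)
        · nlinarith [h t ht j hij, hi t ht, hy.nonneg i j t, hy.le_one i j t]
    _ = Fintype.card ι * (M - y i t) - 0 := by
        rw [Finset.sum_const, Finset.card_univ, nsmul_eq_mul, sub_zero]

theorem pullGain_mul_le_gap (hy : IsConsensusFlow a y) {s δ M α c : ℝ} (hs : 0 ≤ s) (hδ : 0 ≤ δ)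
    (hc : 0 ≤ c) {i j : ι} (hα : ∀ t ∈ Icc s (s + δ), α ≤ a j i t)
    (hi : ∀ t ∈ Icc s (s + δ), c ≤ M - y i t) (hj : ∀ t ∈ Icc s (s + δ), y j t ≤ M)
    (h : ∀ t ∈ Icc s (s + δ), ∀ k, a j k t ≠ 0 → y k t ≤ M) :
    pullGain ι α δ * c ≤ M - y j (s + δ) := by
  have hrate : ∀ t ∈ Ico s (s + δ),
      ∑ k, a j k t * (y k t - y j t) ≤ Fintype.card ι * (M - y j t) - α * c := by
    intro t ht
    replace ht := Ico_subset_Icc_self ht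
    have hpull : α * c ≤ ∑ k, a j k t * (M - y k t) := by
      refine (mul_le_mul (hα t ht) (hi t ht) hc (hy.nonneg j i t)).trans <|
        Finset.single_le_sum (f := fun k => a j k t * (M - y k t)) (fun k _ => ?_)
          (Finset.mem_univ i)
      by_cases hjk : a j k t = 0
      · rw [hjk, zero_mul]
      · exact mul_nonneg (hy.nonneg j k t) (sub_nonneg.2 (h t ht k hjk))
    have hsum : ∑ k, a j k t * (y k t - y j t) ≤
        ∑ k : ι, ((M - y j t) - a j k t * (M - y k t)) :=
      Finset.sum_le_sum fun k _ => by nlinarith [hj t ht, hy.le_one j k t]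
    rw [Finset.sum_sub_distrib, Finset.sum_const, Finset.card_univ, nsmul_eq_mul] at hsum
    linarith
  have : Nonempty ι := ⟨i⟩
  have hcard : -(Fintype.card ι : ℝ) ≠ 0 := neg_ne_zero.2 (Nat.cast_ne_zero.2 Fintype.card_ne_zero)
  have hgap := hy.gronwallBound_le_gap hs hrate (s + δ) ⟨by linarith, le_rfl⟩
  rw [gronwallBound_of_K_ne_0 hcard, add_sub_cancel_left] at hgap
  have hinit : 0 ≤ (M - y j s) * Real.exp (-Fintype.card ι * δ) :=
    mul_nonneg (sub_nonneg.2 (hj s ⟨le_rfl, by linarith⟩)) (Real.exp_nonneg _)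
  calc pullGain ι α δ * c
      = α * c / -Fintype.card ι * (Real.exp (-Fintype.card ι * δ) - 1) := by
        rw [pullGain, div_neg]
        ring
    _ ≤ M - y j (s + δ) := by linarith

theorem gap_mul_exp_le_of_isIsolatedOn_of_lt (hy : IsConsensusFlow a y) {s b M : ℝ} (hs : 0 ≤ s)
    {S : Finset ι} (hS : IsIsolatedOn a S (Ico s b)) (hM : ∀ i ∈ S, y i s < M) :
    ∀ t ∈ Icc s b, ∀ i ∈ S,
      (M - y i s) * Real.exp (-Fintype.card ι * (t - s)) ≤ M - y i t := by
  -- Continuous induction: the decay estimate at `t` keeps the gaps positive slightly beyond `t`,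
  -- and as long as no gap is negative, each agent separately satisfies the estimate.
  refine IsClosed.Icc_subset_of_forall_exists_gt
    (s := {t | ∀ i ∈ S, (M - y i s) * Real.exp (-Fintype.card ι * (t - s)) ≤ M - y i t})
    ?_ (fun i _ => by simp) ?_
  · have hset : {t | ∀ i ∈ S, (M - y i s) * Real.exp (-Fintype.card ι * (t - s)) ≤ M - y i t} ∩
        Icc s b = Icc s b ∩ ⋂ i ∈ S, {t ∈ Icc s b |
          (M - y i s) * Real.exp (-Fintype.card ι * (t - s)) ≤ M - y i t} := by
      ext t
      simp only [mem_inter_iff, mem_iInter, mem_ofPred_eq]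
      grind
    rw [hset]
    refine isClosed_Icc.inter <| isClosed_biInter fun i _ =>
      isClosed_Icc.isClosed_le (by fun_prop) ?_
    exact continuousOn_const.sub ((hy.continuousOn i).mono fun t ht => hs.trans ht.1)
  · rintro t ⟨htS, ht⟩ t' htt'
    have ht0 : 0 ≤ t := hs.trans ht.1
    obtain ⟨v, ⟨htv, hvt'⟩, hvM⟩ := exists_forall_Ico_lt
      (fun i _ => (hy.continuousOn i t ht0).mono (Ici_subset_Ici.2 ht0))
      (fun i hi => sub_pos.1 <|
        (mul_pos (sub_pos.2 (hM i hi)) (Real.exp_pos _)).trans_le (htS i hi))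
      (lt_min htt' ht.2)
    have hsub : Ico t v ⊆ Ico s b := Ico_subset_Ico ht.1 (hvt'.trans (min_le_right _ _))
    refine ⟨v, fun i hi => ?_, htv, hvt'.trans (min_le_left _ _)⟩
    calc (M - y i s) * Real.exp (-Fintype.card ι * (v - s))
        = (M - y i s) * Real.exp (-Fintype.card ι * (t - s)) *
            Real.exp (-Fintype.card ι * (v - t)) := by
          rw [mul_assoc, ← Real.exp_add]
          ring_nf
      _ ≤ (M - y i t) * Real.exp (-Fintype.card ι * (v - t)) :=
          mul_le_mul_of_nonneg_right (htS i hi) (Real.exp_nonneg _)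
      _ ≤ M - y i v := hy.gap_mul_exp_le ht0 (fun u hu => (hvM u hu i hi).le)
          (fun u hu j hij => (hvM u hu j (hS.mem_of_ne_zero (hsub hu) hi hij)).le) v
          ⟨htv.le, le_rfl⟩

theorem gap_mul_exp_le_of_isIsolatedOn (hy : IsConsensusFlow a y) {s b M : ℝ} (hs : 0 ≤ s)
    {S : Finset ι} (hS : IsIsolatedOn a S (Ico s b)) (hM : ∀ i ∈ S, y i s ≤ M) :
    ∀ t ∈ Icc s b, ∀ i ∈ S,
      (M - y i s) * Real.exp (-Fintype.card ι * (t - s)) ≤ M - y i t := by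
  intro t ht i hi
  refine le_of_forall_pos_le_add fun ε hε => ?_
  have hstrict := hy.gap_mul_exp_le_of_isIsolatedOn_of_lt hs hS (M := M + ε)
    (fun j hj => by linarith [hM j hj]) t ht i hi
  have hexp := mul_nonneg hε.le (Real.exp_nonneg (-Fintype.card ι * (t - s)))
  linarith

theorem mul_exp_le_gap_of_isIsolatedOn (hy : IsConsensusFlow a y) {s b M c L : ℝ} (hs : 0 ≤ s)
    {S : Finset ι} (hS : IsIsolatedOn a S (Ico s b)) (hM : ∀ i ∈ S, y i s ≤ M) (hc : 0 ≤ c) {i : ι}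
    (hi : i ∈ S) (hci : c ≤ M - y i s) {t : ℝ} (ht : t ∈ Icc s b) (htL : t ≤ s + L) :
    c * Real.exp (-Fintype.card ι * L) ≤ M - y i t := by
  refine le_trans (mul_le_mul hci (Real.exp_le_exp.2 ?_) (Real.exp_nonneg _) (hc.trans hci))
    (hy.gap_mul_exp_le_of_isIsolatedOn hs hS hM t ht i hi)
  exact mul_le_mul_of_nonpos_left (by linarith) (neg_nonpos.2 (Nat.cast_nonneg _))

theorem le_of_isIsolatedOn (hy : IsConsensusFlow a y) {s b M : ℝ} (hs : 0 ≤ s) {S : Finset ι}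
    (hS : IsIsolatedOn a S (Ico s b)) (hM : ∀ i ∈ S, y i s ≤ M) :
    ∀ t ∈ Icc s b, ∀ i ∈ S, y i t ≤ M := fun t ht i hi =>
  sub_nonneg.1 <| (mul_nonneg (sub_nonneg.2 (hM i hi)) (Real.exp_nonneg _)).trans <|
    hy.gap_mul_exp_le_of_isIsolatedOn hs hS hM t ht i hi

theorem ge_of_isIsolatedOn (hy : IsConsensusFlow a y) {s b M : ℝ} (hs : 0 ≤ s) {S : Finset ι}
    (hS : IsIsolatedOn a S (Ico s b)) (hM : ∀ i ∈ S, M ≤ y i s) :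
    ∀ t ∈ Icc s b, ∀ i ∈ S, M ≤ y i t := fun t ht i hi =>
  neg_le_neg_iff.1 <|
    hy.neg.le_of_isIsolatedOn hs hS (fun j hj => neg_le_neg (hM j hj)) t ht i hi

theorem sub_le_of_isIsolatedOn (hy : IsConsensusFlow a y) {s b B : ℝ} (hs : 0 ≤ s) {S : Finset ι}
    (hS : IsIsolatedOn a S (Ico s b)) (hB : ∀ i ∈ S, ∀ j ∈ S, y i s - y j s ≤ B) :
    ∀ t ∈ Icc s b, ∀ i ∈ S, ∀ j ∈ S, y i t - y j t ≤ B := by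
  intro t ht i hi j hj
  obtain ⟨p, hp, hmax⟩ := S.exists_max_image (fun k => y k s) ⟨i, hi⟩
  obtain ⟨q, hq, hmin⟩ := S.exists_min_image (fun k => y k s) ⟨i, hi⟩
  linarith [hB p hp q hq, hy.le_of_isIsolatedOn hs hS hmax t ht i hi,
    hy.ge_of_isIsolatedOn hs hS hmin t ht j hj]

theorem exists_abs_le (hy : IsConsensusFlow a y) : ∃ r, ∀ t, 0 ≤ t → ∀ i, |y i t| ≤ r := by
  obtain ⟨r, hr⟩ := Finite.bddAbove_range fun i => |y i 0|
  have hinit : ∀ i, |y i 0| ≤ r := fun i => hr (mem_range_self i)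
  refine ⟨r, fun t ht i => abs_le.2 ⟨?_, ?_⟩⟩
  · exact hy.ge_of_isIsolatedOn le_rfl (isIsolatedOn_univ _) (fun j _ => (abs_le.1 (hinit j)).1) t
      ⟨ht, le_rfl⟩ i (Finset.mem_univ i)
  · exact hy.le_of_isIsolatedOn le_rfl (isIsolatedOn_univ _) (fun j _ => (abs_le.1 (hinit j)).2) t
      ⟨ht, le_rfl⟩ i (Finset.mem_univ i)

end IsConsensusFlow

end Consensus

section Reciprocity

variable {ι : Type*} {a : ι → ι → ℝ → ℝ} {y : ι → ℝ → ℝ}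

/-- Non-instantaneous reciprocity, driven by symmetric events `E i j s`: an active weight `a i j`
was preceded by an event at most `W` time units ago, and every event makes the weights of both
agents at least `α` for a duration `δ` within the following `W` time units. For the robots, the
events are the wake-ups at which two robots are at distance at least `d₁`. -/
structure IsReciprocal (a : ι → ι → ℝ → ℝ) (E : ι → ι → ℝ → Prop) (α δ W : ℝ) : Prop where
  weight_pos : 0 < α
  duration_pos : 0 < δ
  lag_nonneg : 0 ≤ W
  symm : ∀ i j s, E i j s → E j i s
  exists_event : ∀ i j t, a i j t ≠ 0 → ∃ s ∈ Icc (t - W) t, E i j s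
  exists_active : ∀ i j s, E i j s →
    ∃ h, s ≤ h ∧ h + δ ≤ s + W ∧ ∀ t ∈ Icc h (h + δ), α ≤ a i j t

/-- A connected component of the graph of recurrent events: from time `T₀` on, the agents in `C`
are not influenced from outside, and every nonempty proper part of `C` has events with the rest of
`C` at arbitrarily late times. -/
structure IsRecurrentComponent (a : ι → ι → ℝ → ℝ) (E : ι → ι → ℝ → Prop) (C : Finset ι)
    (T₀ : ℝ) : Prop where
  start_nonneg : 0 ≤ T₀
  isolated : IsIsolatedOn a C (Ici T₀)
  connected : ∀ S ⊂ C, S.Nonempty → ∃ i ∈ S, ∃ j ∈ C, j ∉ S ∧ ∃ᶠ s in atTop, E i j s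

variable {E : ι → ι → ℝ → Prop} {α δ W : ℝ}

theorem IsReciprocal.exists_isRecurrentComponent [Finite ι] (hE : IsReciprocal a E α δ W)
    (i : ι) :
    ∃ C T₀, IsRecurrentComponent a E C T₀ ∧ i ∈ C ∧ ∀ j, (∃ᶠ s in atTop, E i j s) → j ∈ C := by
  obtain ⟨C, hi, hclosed, hconn⟩ := exists_finset_closed_connected
    (R := fun j k => ∃ᶠ s in atTop, E j k s) (fun j k h => h.mono fun s => hE.symm j k s) i
  have hev : ∀ᶠ s in atTop, ∀ j ∈ C, ∀ k ∉ C, ¬ E j k s :=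
    (Finset.eventually_all C).2 fun j hj => eventually_all.2 fun k =>
      eventually_imp_distrib_left.2 fun hk => not_frequently.1 (hclosed j hj k hk)
  obtain ⟨T, hT⟩ := eventually_atTop.1 hev
  have hTle : T ≤ max T 0 := le_max_left _ _
  refine ⟨C, max T 0 + W, ⟨add_nonneg (le_max_right _ _) hE.lag_nonneg, ?_, hconn⟩, hi,
    fun j hij => not_imp_comm.1 (hclosed i hi j) (not_not.2 hij)⟩
  intro t ht j hj k hk
  by_contra hjk
  obtain ⟨s, hs, hEs⟩ := hE.exists_event j k t hjk
  exact hT s (by linarith [hs.1, mem_Ici.1 ht]) j hj k hk hEs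

namespace IsRecurrentComponent

variable {C S : Finset ι} {T₀ s b M c : ℝ}

theorem isIsolatedOn_Ico (hC : IsRecurrentComponent a E C T₀) (hs : T₀ ≤ s) :
    IsIsolatedOn a C (Ico s b) :=
  hC.isolated.mono fun _ ht => hs.trans ht.1

variable [Fintype ι]

theorem le_of_le (hC : IsRecurrentComponent a E C T₀) (hy : IsConsensusFlow a y) (hs : T₀ ≤ s)
    (hM : ∀ i ∈ C, y i s ≤ M) {t : ℝ} (ht : s ≤ t) : ∀ i ∈ C, y i t ≤ M :=
  hy.le_of_isIsolatedOn (hC.start_nonneg.trans hs) (hC.isIsolatedOn_Ico hs) hM t ⟨ht, le_rfl⟩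

theorem mul_exp_le_gap (hC : IsRecurrentComponent a E C T₀) (hy : IsConsensusFlow a y)
    (hs : T₀ ≤ s) (hM : ∀ i ∈ C, y i s ≤ M) (hc : 0 ≤ c) {i : ι} (hi : i ∈ C)
    (hci : c ≤ M - y i s) {t L : ℝ} (hst : s ≤ t) (htL : t ≤ s + L) :
    c * Real.exp (-Fintype.card ι * L) ≤ M - y i t :=
  hy.mul_exp_le_gap_of_isIsolatedOn (hC.start_nonneg.trans hs) (hC.isIsolatedOn_Ico hs) hM hc hi
    hci ⟨hst, le_rfl⟩ htL

theorem mul_exp_le_gap_of_no_event (hC : IsRecurrentComponent a E C T₀)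
    (hE : IsReciprocal a E α δ W) (hy : IsConsensusFlow a y) (hs : T₀ ≤ s) (hS : S ⊆ C)
    (hM : ∀ i ∈ C, y i s ≤ M) (hc : 0 ≤ c) (hcS : ∀ i ∈ S, c ≤ M - y i s)
    (hno : ∀ t ∈ Ico s b, ∀ i ∈ S, ∀ j ∈ C, j ∉ S → ¬ E i j t) :
    ∀ t ∈ Icc s b, ∀ i ∈ S, c * Real.exp (-Fintype.card ι * W) ≤ M - y i t := by
  intro t ht i hi
  have hW := hE.lag_nonneg
  rcases le_total t (s + W) with htW | htW
  · exact hC.mul_exp_le_gap hy hs hM hc (hS hi) (hcS i hi) ht.1 htW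
  -- Weights active after time `s + W` come from events after time `s`: `S` is isolated by then.
  · have hiso : IsIsolatedOn a S (Ico (s + W) b) := by
      intro u hu j hj k hk
      by_contra hjk
      have hkC : k ∈ C := hC.isolated.mem_of_ne_zero (mem_Ici.2 (by linarith [hu.1]))
        (hS hj) hjk
      obtain ⟨v, hv, hEv⟩ := hE.exists_event j k u hjk
      exact hno v ⟨by linarith [hu.1, hv.1], hv.2.trans_lt hu.2⟩ j hj k hkC hk hEv
    have hgap : ∀ j ∈ S, y j (s + W) ≤ M - c * Real.exp (-Fintype.card ι * W) := fun j hj =>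
      le_sub_comm.1 <|
        hC.mul_exp_le_gap hy hs hM hc (hS hj) (hcS j hj) (le_add_of_nonneg_right hW) le_rfl
    exact le_sub_comm.1 <| hy.le_of_isIsolatedOn (by linarith [hC.start_nonneg]) hiso hgap t
      ⟨htW, ht.2⟩ i hi

/-- The time lag between `b` and the event at `t` is there because a first event need not exist. -/
theorem exists_next_event (hC : IsRecurrentComponent a E C T₀) (hE : IsReciprocal a E α δ W)
    (hy : IsConsensusFlow a y) (hs : T₀ ≤ s) (hS : S ⊂ C) (hSn : S.Nonempty)
    (hM : ∀ i ∈ C, y i s ≤ M) (hc : 0 ≤ c) (hcS : ∀ i ∈ S, c ≤ M - y i s) :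
    ∃ b t, s ≤ b ∧ b ≤ t ∧ t ≤ b + 1 ∧ (∃ i ∈ S, ∃ j ∈ C, j ∉ S ∧ E i j t) ∧
      ∀ i ∈ S, c * Real.exp (-Fintype.card ι * W) ≤ M - y i b := by
  set A : Set ℝ := {t | s ≤ t ∧ ∃ i ∈ S, ∃ j ∈ C, j ∉ S ∧ E i j t}
  have hbdd : BddBelow A := ⟨s, fun t ht => ht.1⟩
  have hne : A.Nonempty := by
    obtain ⟨i, hi, j, hj, hjS, hij⟩ := hC.connected S hS hSn
    obtain ⟨t, hst, ht⟩ := frequently_atTop.1 hij s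
    exact ⟨t, hst, i, hi, j, hj, hjS, ht⟩
  obtain ⟨t, htA, ht⟩ := exists_lt_of_csInf_lt hne (lt_add_one (sInf A))
  have hsA : s ≤ sInf A := le_csInf hne fun t ht => ht.1
  refine ⟨sInf A, t, hsA, csInf_le hbdd htA, ht.le, htA.2, ?_⟩
  refine hC.mul_exp_le_gap_of_no_event hE hy hs hS.subset hM hc hcS ?_ _ ⟨hsA, le_rfl⟩
  exact fun u hu i hi j hj hjS hij =>
    notMem_of_lt_csInf hu.2 hbdd ⟨hu.1, i, hi, j, hj, hjS, hij⟩

theorem pullGain_mul_le_gap_of_event (hC : IsRecurrentComponent a E C T₀)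
    (hE : IsReciprocal a E α δ W) (hy : IsConsensusFlow a y) (hs : T₀ ≤ s)
    (hM : ∀ i ∈ C, y i s ≤ M) (hc : 0 ≤ c) {i j : ι} (hj : j ∈ C) (hij : E i j s)
    (hi : ∀ t ∈ Icc s (s + W), c ≤ M - y i t) :
    pullGain ι α δ * c * Real.exp (-Fintype.card ι * W) ≤ M - y j (s + W) := by
  have : Nonempty ι := ⟨i⟩
  obtain ⟨h, hsh, hhW, hactive⟩ := hE.exists_active j i s (hE.symm i j s hij)
  have hδ := hE.duration_pos
  have hMt : ∀ t ∈ Icc h (h + δ), ∀ k ∈ C, y k t ≤ M := fun t ht =>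
    hC.le_of_le hy hs hM (hsh.trans ht.1)
  have hpull := hy.pullGain_mul_le_gap (hC.start_nonneg.trans (hs.trans hsh)) hδ.le hc hactive
    (fun t ht => hi t ⟨hsh.trans ht.1, ht.2.trans hhW⟩) (fun t ht => hMt t ht j hj)
    fun t ht k hk => hMt t ht k
      (hC.isolated.mem_of_ne_zero (hs.trans (hsh.trans ht.1)) hj hk)
  exact hC.mul_exp_le_gap hy (by linarith) (hMt _ ⟨by linarith, le_rfl⟩)
    (mul_nonneg (pullGain_pos hE.weight_pos hδ).le hc) hj hpull hhW (by linarith)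

theorem exists_insert_gap [DecidableEq ι] (hC : IsRecurrentComponent a E C T₀)
    (hE : IsReciprocal a E α δ W) (hy : IsConsensusFlow a y) :
    ∃ κ : ℝ, 0 < κ ∧ ∀ (s M c : ℝ) (S : Finset ι), T₀ ≤ s → S ⊂ C → S.Nonempty →
      (∀ i ∈ C, y i s ≤ M) → 0 ≤ c → (∀ i ∈ S, c ≤ M - y i s) →
      ∃ s', s ≤ s' ∧ ∃ j ∈ C, j ∉ S ∧ ∀ i ∈ insert j S, κ * c ≤ M - y i s' := by
  rcases isEmpty_or_nonempty ι with hι | hι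
  · exact ⟨1, one_pos, fun s M c S _ _ ⟨i, _⟩ => isEmptyElim i⟩
  have hW := hE.lag_nonneg
  set e : ℝ → ℝ := fun L => Real.exp (-Fintype.card ι * L)
  have he0 : ∀ L, 0 < e L := fun L => Real.exp_pos _
  have hgain : 0 < pullGain ι α δ := pullGain_pos hE.weight_pos hE.duration_pos
  refine ⟨e W * e (1 + W) * min 1 (pullGain ι α δ * e W), mul_pos (mul_pos (he0 _) (he0 _))
    (lt_min one_pos (mul_pos hgain (he0 W))), fun s M c S hs hS hSn hM hc hcS => ?_⟩
  obtain ⟨b, t, hsb, hbt, htb, ⟨i, hi, j, hj, hjS, hij⟩, hgap⟩ :=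
    hC.exists_next_event hE hy hs hS hSn hM hc hcS
  have hMb := hC.le_of_le hy hs hM hsb
  have hgapS : ∀ k ∈ S, ∀ u ∈ Icc t (t + W), c * e W * e (1 + W) ≤ M - y k u :=
    fun k hk u hu => hC.mul_exp_le_gap hy (hs.trans hsb) hMb (mul_nonneg hc (he0 W).le)
      (hS.subset hk) (hgap k hk) (hbt.trans hu.1) (by linarith [hu.2])
  have hc' : 0 ≤ c * e W * e (1 + W) := mul_nonneg (mul_nonneg hc (he0 _).le) (he0 _).le
  have hgapj := hC.pullGain_mul_le_gap_of_event hE hy (hs.trans (hsb.trans hbt))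
    (hC.le_of_le hy (hs.trans hsb) hMb hbt) hc' hj hij (hgapS i hi)
  refine ⟨t + W, by linarith, j, hj, hjS, fun k hk => ?_⟩
  rw [show e W * e (1 + W) * min 1 (pullGain ι α δ * e W) * c =
    min 1 (pullGain ι α δ * e W) * (c * e W * e (1 + W)) by ring]
  rcases Finset.mem_insert.1 hk with rfl | hk
  · refine (mul_le_mul_of_nonneg_right (min_le_right _ _) hc').trans (le_trans (le_of_eq ?_) hgapj)
    ring
  · refine (mul_le_mul_of_nonneg_right (min_le_left _ _) hc').trans ?_
    rw [one_mul]
    exact hgapS k hk _ ⟨by linarith, le_rfl⟩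

theorem exists_forall_gap (hC : IsRecurrentComponent a E C T₀) (hE : IsReciprocal a E α δ W)
    (hy : IsConsensusFlow a y) :
    ∃ κ : ℝ, 0 < κ ∧ ∀ (s M c : ℝ), T₀ ≤ s → (∀ i ∈ C, y i s ≤ M) → 0 ≤ c →
      (∃ i ∈ C, c ≤ M - y i s) → ∃ s', s ≤ s' ∧ ∀ i ∈ C, κ * c ≤ M - y i s' := by
  classical
  obtain ⟨κ, hκ, hgrow⟩ := hC.exists_insert_gap hE hy
  refine ⟨κ ^ (C.card - 1), pow_pos hκ _, fun s M c hs hM hc ⟨i, hi, hci⟩ => ?_⟩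
  have hstep : ∀ m < C.card, ∃ s', s ≤ s' ∧ ∃ S ⊆ C, S.card = m + 1 ∧
      ∀ j ∈ S, κ ^ m * c ≤ M - y j s' := by
    intro m
    induction m with
    | zero => exact fun _ => ⟨s, le_rfl, {i}, by simpa using hi, by simp, by simpa using hci⟩
    | succ m ih =>
      intro hm
      obtain ⟨s₁, hs₁, S, hSC, hcard, hgap⟩ := ih (by lia)
      have hS : S ⊂ C := hSC.ssubset_of_ne (by rintro rfl; lia)
      obtain ⟨s₂, hs₂, j, hj, hjS, hgap'⟩ := hgrow s₁ M (κ ^ m * c) S (hs.trans hs₁) hS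
        (Finset.card_pos.1 (by lia)) (hC.le_of_le hy hs hM hs₁)
        (mul_nonneg (pow_pos hκ m).le hc) hgap
      refine ⟨s₂, hs₁.trans hs₂, insert j S, Finset.insert_subset hj hSC, ?_, fun k hk => ?_⟩
      · rw [Finset.card_insert_of_notMem hjS, hcard]
      · rw [pow_succ', mul_assoc]
        exact hgap' k hk
  have hcard : 0 < C.card := Finset.card_pos.2 ⟨i, hi⟩
  obtain ⟨s', hs', S, hSC, hScard, hgap⟩ := hstep (C.card - 1) (by lia)
  rw [Finset.eq_of_subset_of_card_le hSC (by lia)] at hgap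
  exact ⟨s', hs', hgap⟩

theorem exists_contraction (hC : IsRecurrentComponent a E C T₀) (hE : IsReciprocal a E α δ W)
    (hy : IsConsensusFlow a y) :
    ∃ ρ : ℝ, 0 ≤ ρ ∧ ρ < 1 ∧ ∀ s B : ℝ, T₀ ≤ s → (∀ i ∈ C, ∀ j ∈ C, y i s - y j s ≤ B) →
      ∃ s', s ≤ s' ∧ ∀ i ∈ C, ∀ j ∈ C, y i s' - y j s' ≤ ρ * B := by
  obtain ⟨κ, hκ, hgap⟩ := hC.exists_forall_gap hE hy
  have hθ : 0 < min κ 1 := lt_min hκ one_pos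
  refine ⟨1 - min κ 1, sub_nonneg.2 (min_le_right _ _), sub_lt_self _ hθ, fun s B hs hB => ?_⟩
  rcases C.eq_empty_or_nonempty with rfl | hCn
  · exact ⟨s, le_rfl, by simp⟩
  obtain ⟨p, hp, hmax⟩ := C.exists_max_image (fun i => y i s) hCn
  obtain ⟨q, hq, hmin⟩ := C.exists_min_image (fun i => y i s) hCn
  have hpq : 0 ≤ y p s - y q s := sub_nonneg.2 (hmax q hq)
  obtain ⟨s', hs', hs'gap⟩ := hgap s (y p s) (y p s - y q s) hs hmax hpq ⟨q, hq, le_rfl⟩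
  refine ⟨s', hs', fun i hi j hj => ?_⟩
  have hlow : y q s ≤ y j s' :=
    hy.ge_of_isIsolatedOn (hC.start_nonneg.trans hs) (hC.isIsolatedOn_Ico hs) hmin s'
      ⟨hs', le_rfl⟩ j hj
  calc y i s' - y j s' ≤ (1 - κ) * (y p s - y q s) := by linarith [hs'gap i hi]
    _ ≤ (1 - min κ 1) * (y p s - y q s) :=
        mul_le_mul_of_nonneg_right (sub_le_sub_left (min_le_left _ _) _) hpq
    _ ≤ (1 - min κ 1) * B :=
        mul_le_mul_of_nonneg_left (hB p hp q hq) (sub_nonneg.2 (min_le_right _ _))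

theorem eventually_sub_le (hC : IsRecurrentComponent a E C T₀) (hE : IsReciprocal a E α δ W)
    (hy : IsConsensusFlow a y) {ε : ℝ} (hε : 0 < ε) :
    ∀ᶠ t in atTop, ∀ i ∈ C, ∀ j ∈ C, y i t - y j t ≤ ε := by
  obtain ⟨ρ, hρ0, hρ1, hcontr⟩ := hC.exists_contraction hE hy
  obtain ⟨B, hB⟩ := ((C ×ˢ C).image fun p => y p.1 T₀ - y p.2 T₀).bddAbove
  have hiter : ∀ k : ℕ, ∃ s, T₀ ≤ s ∧ ∀ i ∈ C, ∀ j ∈ C, y i s - y j s ≤ ρ ^ k * B := by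
    intro k
    induction k with
    | zero =>
      refine ⟨T₀, le_rfl, fun i hi j hj => ?_⟩
      rw [pow_zero, one_mul]
      exact hB (Finset.mem_image_of_mem (fun p : ι × ι => y p.1 T₀ - y p.2 T₀)
        (Finset.mk_mem_product hi hj))
    | succ k ih =>
      obtain ⟨s, hs, hsB⟩ := ih
      obtain ⟨s', hs', hs'B⟩ := hcontr s _ hs hsB
      refine ⟨s', hs.trans hs', ?_⟩
      rwa [pow_succ', mul_assoc]
  have hlim : Tendsto (fun k : ℕ => ρ ^ k * B) atTop (𝓝 0) := by
    simpa using (tendsto_pow_atTop_nhds_zero_of_lt_one hρ0 hρ1).mul_const B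
  obtain ⟨k, hk⟩ := (hlim.eventually_le_const hε).exists
  obtain ⟨s, hs, hsB⟩ := hiter k
  filter_upwards [eventually_ge_atTop s] with t ht i hi j hj
  exact (hy.sub_le_of_isIsolatedOn (hC.start_nonneg.trans hs) (hC.isIsolatedOn_Ico hs) hsB t
    ⟨ht, le_rfl⟩ i hi j hj).trans hk

end IsRecurrentComponent

theorem IsConsensusFlow.tendsto_sub_of_frequently_event [Fintype ι] (hy : IsConsensusFlow a y)
    (hE : IsReciprocal a E α δ W) {i j : ι} (hij : ∃ᶠ s in atTop, E i j s) :
    Tendsto (fun t => y i t - y j t) atTop (𝓝 0) := by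
  obtain ⟨C, T₀, hC, hi, hCj⟩ := hE.exists_isRecurrentComponent i
  refine Metric.tendsto_nhds.2 fun ε hε => ?_
  filter_upwards [hC.eventually_sub_le hE hy (half_pos hε)] with t ht
  rw [Real.dist_eq, sub_zero]
  exact (abs_sub_le_iff.2 ⟨ht i hi j (hCj j hij), ht j (hCj j hij) i hi⟩).trans_lt (half_lt_self hε)

end Reciprocity

section Schedule

variable {n : ℕ} {δmin δmax : ℝ} {τ : Fin n → ℕ → ℝ}

namespace IsWakeUpSchedule

theorem min_le_max (hτ : IsWakeUpSchedule δmin δmax τ) (i : Fin n) : δmin ≤ δmax :=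
  (hτ.gap_mem i 0).1.trans (hτ.gap_mem i 0).2

theorem max_nonneg (hτ : IsWakeUpSchedule δmin δmax τ) (i : Fin n) : 0 ≤ δmax :=
  (hτ.zero_le i).trans (hτ.first_le i)

theorem mul_le (hτ : IsWakeUpSchedule δmin δmax τ) (i : Fin n) (k : ℕ) : k * δmin ≤ τ i k := by
  induction k with
  | zero => simpa using hτ.zero_le i
  | succ k ih =>
    have hgap := (hτ.gap_mem i k).1
    push_cast
    linarith

theorem nonneg (hτ : IsWakeUpSchedule δmin δmax τ) (hδmin : 0 < δmin) (i : Fin n) (k : ℕ) :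
    0 ≤ τ i k :=
  (mul_nonneg k.cast_nonneg hδmin.le).trans (hτ.mul_le i k)

theorem exists_ge (hτ : IsWakeUpSchedule δmin δmax τ) (hδmin : 0 < δmin) (i : Fin n) (s : ℝ) :
    ∃ k, s ≤ τ i k := by
  obtain ⟨k, hk⟩ := exists_nat_ge (s / δmin)
  exact ⟨k, ((div_le_iff₀ hδmin).1 hk).trans (hτ.mul_le i k)⟩

theorem exists_mem_Icc (hτ : IsWakeUpSchedule δmin δmax τ) (hδmin : 0 < δmin) (i : Fin n) {s : ℝ}
    (hs : 0 ≤ s) : ∃ k, τ i k ∈ Icc s (s + δmax) := by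
  classical
  have hex := hτ.exists_ge hδmin i s
  refine ⟨Nat.find hex, Nat.find_spec hex, ?_⟩
  rcases hfind : Nat.find hex with _ | m
  · linarith [hτ.first_le i]
  · have hlt := not_le.1 (Nat.find_min hex (m := m) (by lia))
    linarith [(hτ.gap_mem i m).2]

end IsWakeUpSchedule

end Schedule

section Trajectory

theorem sat_eq_smul (μ : ℝ) (v : Plane) : sat μ v = (μ / max μ ‖v‖) • v := by
  unfold sat
  split_ifs with h
  · rw [max_eq_right h]
  · have hμ : μ ≠ 0 := by
      rintro rfl
      exact h (norm_nonneg v)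
    rw [max_eq_left (not_le.1 h).le, div_self hμ, one_smul]

theorem norm_sat_le {μ : ℝ} (hμ : 0 < μ) (v : Plane) : ‖sat μ v‖ ≤ μ := by
  have hmax : 0 < max μ ‖v‖ := lt_max_of_lt_left hμ
  rw [sat_eq_smul, norm_smul, Real.norm_of_nonneg (by positivity), div_mul_eq_mul_div,
    div_le_iff₀ hmax]
  exact mul_le_mul_of_nonneg_left (le_max_right _ _) hμ.le

variable {n : ℕ} {μ d₀ d₁ δmin δmax : ℝ} {τ : Fin n → ℕ → ℝ} {x : Fin n → ℝ → Plane} {i j : Fin n}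
  {s t : ℝ}

/-- One of the robots `i` and `j` wakes up at time `s` and finds the other one at distance at
least `d₁`. These are the events that the reciprocity of the dynamics refers to. -/
def IsEngagement (d₁ : ℝ) (τ : Fin n → ℕ → ℝ) (x : Fin n → ℝ → Plane) (i j : Fin n) (s : ℝ) :
    Prop :=
  ((∃ k, τ i k = s) ∨ ∃ k, τ j k = s) ∧ d₁ ≤ ‖x i s - x j s‖

theorem IsEngagement.symm (h : IsEngagement d₁ τ x i j s) : IsEngagement d₁ τ x j i s :=
  ⟨h.1.symm, h.2.trans_eq (norm_sub_rev _ _)⟩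

theorem IsEngagement.nonneg (h : IsEngagement d₁ τ x i j s) (hτ : IsWakeUpSchedule δmin δmax τ)
    (hδmin : 0 < δmin) : 0 ≤ s := by
  obtain ⟨⟨k, rfl⟩ | ⟨k, rfl⟩, -⟩ := h
  exacts [hτ.nonneg hδmin i k, hτ.nonneg hδmin j k]

/-- The weight of the linear dynamics obtained by absorbing the saturation into the weights: the
factor in front of `weight` is the one by which `sat μ` rescales the input of robot `i`. -/
noncomputable def satWeight (μ d₀ d₁ δmin δmax : ℝ) (τ : Fin n → ℕ → ℝ)
    (x : Fin n → ℝ → Plane) (i j : Fin n) (t : ℝ) : ℝ :=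
  μ / max μ ‖∑ k, weight d₀ d₁ δmin δmax τ x i k t • (x k t - x i t)‖ *
    weight d₀ d₁ δmin δmax τ x i j t

theorem weight_nonneg : 0 ≤ weight d₀ d₁ δmin δmax τ x i j t := by
  unfold weight
  split_ifs <;> norm_num

theorem weight_le_one : weight d₀ d₁ δmin δmax τ x i j t ≤ 1 := by
  unfold weight
  split_ifs <;> norm_num

theorem satWeight_nonneg (hμ : 0 < μ) : 0 ≤ satWeight μ d₀ d₁ δmin δmax τ x i j t :=
  mul_nonneg (div_nonneg hμ.le (le_max_of_le_left hμ.le)) weight_nonneg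

theorem satWeight_le_one (hμ : 0 < μ) : satWeight μ d₀ d₁ δmin δmax τ x i j t ≤ 1 :=
  mul_le_one₀ ((div_le_one (lt_max_of_lt_left hμ)).2 (le_max_left _ _)) weight_nonneg weight_le_one

theorem norm_sum_weight_smul_le {r : ℝ} (hr : ∀ j, ‖x j t‖ ≤ r) :
    ‖∑ j, weight d₀ d₁ δmin δmax τ x i j t • (x j t - x i t)‖ ≤ n * (r + r) := by
  have hterm : ∀ j, ‖weight d₀ d₁ δmin δmax τ x i j t • (x j t - x i t)‖ ≤ r + r := fun j => by
    rw [norm_smul, Real.norm_of_nonneg weight_nonneg]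
    exact (mul_le_of_le_one_left (norm_nonneg _) weight_le_one).trans
      ((norm_sub_le _ _).trans (add_le_add (hr j) (hr i)))
  refine (norm_sum_le_of_le Finset.univ fun j _ => hterm j).trans_eq ?_
  rw [Finset.sum_const, Finset.card_univ, Fintype.card_fin, nsmul_eq_mul]

theorem velocity_apply (i : Fin n) (t : ℝ) (k : Fin 2) :
    velocity μ d₀ d₁ δmin δmax τ x i t k =
      ∑ j, satWeight μ d₀ d₁ δmin δmax τ x i j t * (x j t k - x i t k) := by
  simp only [velocity, satWeight, sat_eq_smul, PiLp.smul_apply, WithLp.ofLp_sum, Finset.sum_apply,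
    PiLp.sub_apply, smul_eq_mul, Finset.mul_sum, mul_assoc]

theorem exists_isEngagement_of_weight_ne_zero (hτ : IsWakeUpSchedule δmin δmax τ)
    (h : weight d₀ d₁ δmin δmax τ x i j t ≠ 0) :
    ∃ s ∈ Icc (t - 2 * δmax) t, IsEngagement d₁ τ x i j s := by
  have hδ := hτ.min_le_max i
  have hδmax := hτ.max_nonneg i
  have hactive : Engages d₁ δmin τ x i j t ∨ Reciprocates d₀ d₁ δmin δmax τ x i j t := by
    by_contra hno
    exact h (if_neg hno)
  rcases hactive with ⟨k, hk, hd⟩ | ⟨l, hl, -, k, hk, hd⟩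
  · exact ⟨τ i k, ⟨by linarith [hk.2], hk.1⟩, Or.inl ⟨k, rfl⟩, hd⟩
  · exact ⟨τ j k, ⟨by linarith [hl.2, hk.1], hk.2.trans hl.1⟩, Or.inr ⟨k, rfl⟩, hd⟩

namespace IsTrajectory

theorem integrable (hx : IsTrajectory μ d₀ d₁ δmin δmax τ x) (i : Fin n) (hs : 0 ≤ s)
    (hst : s ≤ t) : IntervalIntegrable (velocity μ d₀ d₁ δmin δmax τ x i) volume s t :=
  (hx i s hs).1.symm.trans (hx i t (hs.trans hst)).1

theorem sub_eq (hx : IsTrajectory μ d₀ d₁ δmin δmax τ x) (i : Fin n) (hs : 0 ≤ s) (hst : s ≤ t) :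
    x i t - x i s = ∫ u in s..t, velocity μ d₀ d₁ δmin δmax τ x i u := by
  rw [(hx i t (hs.trans hst)).2, (hx i s hs).2, add_sub_add_left_eq_sub,
    intervalIntegral.integral_interval_sub_left (hx i t (hs.trans hst)).1 (hx i s hs).1]

theorem norm_displacement_le (hx : IsTrajectory μ d₀ d₁ δmin δmax τ x) (hμ : 0 < μ) (i : Fin n)
    (hs : 0 ≤ s) (hst : s ≤ t) : ‖x i t - x i s‖ ≤ μ * (t - s) := by
  rw [hx.sub_eq i hs hst, ← abs_of_nonneg (sub_nonneg.2 hst)]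
  exact intervalIntegral.norm_integral_le_of_norm_le_const fun u _ => norm_sat_le hμ _

theorem norm_sub_le_add (hx : IsTrajectory μ d₀ d₁ δmin δmax τ x) (hμ : 0 < μ) (i j : Fin n)
    (hs : 0 ≤ s) (hst : s ≤ t) : ‖x i s - x j s‖ ≤ ‖x i t - x j t‖ + 2 * μ * (t - s) :=
  calc ‖x i s - x j s‖ = ‖(x i t - x j t) - (x i t - x i s) + (x j t - x j s)‖ := by abel_nf
    _ ≤ ‖x i t - x j t‖ + ‖x i t - x i s‖ + ‖x j t - x j s‖ :=
        (norm_add_le _ _).trans (by gcongr; exact norm_sub_le _ _)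
    _ ≤ ‖x i t - x j t‖ + 2 * μ * (t - s) := by
        linarith [hx.norm_displacement_le hμ i hs hst, hx.norm_displacement_le hμ j hs hst]

theorem isConsensusFlow (hx : IsTrajectory μ d₀ d₁ δmin δmax τ x) (hμ : 0 < μ) (k : Fin 2) :
    IsConsensusFlow (satWeight μ d₀ d₁ δmin δmax τ x) (fun i t => x i t k) := by
  have hsum : ∀ i,
      (fun u => ∑ j, satWeight μ d₀ d₁ δmin δmax τ x i j u * (x j u k - x i u k)) =
        fun u => (EuclideanSpace.proj k : Plane →L[ℝ] ℝ) (velocity μ d₀ d₁ δmin δmax τ x i u) :=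
    fun i => funext fun u => (velocity_apply i u k).symm
  refine ⟨fun i j t => satWeight_nonneg hμ, fun i j t => satWeight_le_one hμ,
    fun i s t hs hst => ?_, fun i s t hs hst => ?_⟩
  · rw [hsum]
    have hint := hx.integrable i hs hst
    exact ⟨ContinuousLinearMap.integrable_comp _ hint.1,
      ContinuousLinearMap.integrable_comp _ hint.2⟩
  · rw [hsum, ContinuousLinearMap.intervalIntegral_comp_comm _ (hx.integrable i hs hst),
      ← hx.sub_eq i hs hst]
    rfl

theorem exists_norm_le (hx : IsTrajectory μ d₀ d₁ δmin δmax τ x) (hμ : 0 < μ) :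
    ∃ r, ∀ t, 0 ≤ t → ∀ i, ‖x i t‖ ≤ r := by
  choose r hr using fun k => (hx.isConsensusFlow hμ k).exists_abs_le
  exact ⟨∑ k, r k, fun t ht i =>
    (norm_le_sum_abs _).trans (Finset.sum_le_sum fun k _ => hr k t ht i)⟩

theorem exists_mul_weight_le_satWeight (hx : IsTrajectory μ d₀ d₁ δmin δmax τ x) (hμ : 0 < μ) :
    ∃ α : ℝ, 0 < α ∧ ∀ i j t, 0 ≤ t →
      α * weight d₀ d₁ δmin δmax τ x i j t ≤ satWeight μ d₀ d₁ δmin δmax τ x i j t := by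
  obtain ⟨r, hr⟩ := hx.exists_norm_le hμ
  refine ⟨μ / max μ (n * (r + r)), div_pos hμ (lt_max_of_lt_left hμ), fun i j t ht => ?_⟩
  exact mul_le_mul_of_nonneg_right (div_le_div_of_nonneg_left hμ.le (lt_max_of_lt_left hμ)
    (max_le_max_left μ (norm_sum_weight_smul_le (hr t ht)))) weight_nonneg

theorem exists_weight_eq_one (hx : IsTrajectory μ d₀ d₁ δmin δmax τ x) (hμ : 0 < μ)
    (hδmin : 0 < δmin) (hspeed : 4 * δmax * μ ≤ d₁ - d₀) (hτ : IsWakeUpSchedule δmin δmax τ)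
    (h : IsEngagement d₁ τ x i j s) :
    ∃ b, s ≤ b ∧ b + δmin ≤ s + 2 * δmax ∧
      ∀ t ∈ Icc b (b + δmin), weight d₀ d₁ δmin δmax τ x i j t = 1 := by
  have hδ := hτ.min_le_max i
  obtain ⟨⟨k, rfl⟩ | ⟨k, rfl⟩, hd⟩ := h
  · exact ⟨τ i k, le_rfl, by linarith, fun t ht => if_pos (Or.inl ⟨k, ht, hd⟩)⟩
  · have hs := hτ.nonneg hδmin j k
    obtain ⟨m, hm⟩ := hτ.exists_mem_Icc hδmin i hs
    refine ⟨τ i m, hm.1, by linarith [hm.2], fun t ht =>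
      if_pos (Or.inr ⟨m, ht, ?_, k, ⟨by linarith [hm.2], hm.1⟩, hd⟩)⟩
    have hdrift := hx.norm_sub_le_add hμ i j hs (hm.1.trans ht.1)
    have htime : μ * (t - τ j k) ≤ μ * (2 * δmax) :=
      mul_le_mul_of_nonneg_left (by linarith [ht.2, hm.2]) hμ.le
    linarith

theorem exists_isReciprocal [NeZero n] (hx : IsTrajectory μ d₀ d₁ δmin δmax τ x) (hμ : 0 < μ)
    (hδmin : 0 < δmin) (hspeed : 4 * δmax * μ ≤ d₁ - d₀) (hτ : IsWakeUpSchedule δmin δmax τ) :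
    ∃ α, IsReciprocal (satWeight μ d₀ d₁ δmin δmax τ x) (IsEngagement d₁ τ x) α δmin
      (2 * δmax) := by
  obtain ⟨α, hα, hαw⟩ := hx.exists_mul_weight_le_satWeight hμ
  refine ⟨α, hα, hδmin, mul_nonneg zero_le_two (hτ.max_nonneg 0), fun i j s => IsEngagement.symm,
    fun i j t h => exists_isEngagement_of_weight_ne_zero hτ (right_ne_zero_of_mul h),
    fun i j s h => ?_⟩
  obtain ⟨b, hsb, hb, hw⟩ := hx.exists_weight_eq_one hμ hδmin hspeed hτ h
  refine ⟨b, hsb, hb, fun t ht => ?_⟩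
  simpa only [hw t ht, mul_one] using hαw i j t ((h.nonneg hτ hδmin).trans (hsb.trans ht.1))

theorem eventually_not_isEngagement (hx : IsTrajectory μ d₀ d₁ δmin δmax τ x) (hμ : 0 < μ)
    (hd₁ : 0 < d₁) (hδmin : 0 < δmin) (hspeed : 4 * δmax * μ ≤ d₁ - d₀)
    (hτ : IsWakeUpSchedule δmin δmax τ) (i j : Fin n) :
    ∀ᶠ s in atTop, ¬ IsEngagement d₁ τ x i j s := by
  by_contra hij
  have : NeZero n := .of_pos i.pos
  obtain ⟨α, hE⟩ := hx.exists_isReciprocal hμ hδmin hspeed hτ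
  have hcoord : ∀ k, Tendsto (fun t => x i t k - x j t k) atTop (𝓝 0) := fun k =>
    (hx.isConsensusFlow hμ k).tendsto_sub_of_frequently_event hE hij
  have hsum : Tendsto (fun t => ∑ k, |x i t k - x j t k|) atTop (𝓝 0) := by
    simpa using tendsto_finsetSum Finset.univ fun k _ => (hcoord k).abs
  obtain ⟨s, hs, hlt⟩ :=
    (Frequently.and_eventually hij (hsum.eventually_lt_const hd₁)).exists
  exact (hs.2.trans (norm_le_sum_abs _)).not_gt hlt

theorem exists_forall_eq (hx : IsTrajectory μ d₀ d₁ δmin δmax τ x) (hμ : 0 < μ) (hd₁ : 0 < d₁)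
    (hδmin : 0 < δmin) (hspeed : 4 * δmax * μ ≤ d₁ - d₀) (hτ : IsWakeUpSchedule δmin δmax τ) :
    ∃ T, (∀ i, ∀ t ≥ T, x i t = x i T) ∧ ∀ i j, ∀ t ≥ T, ¬ IsEngagement d₁ τ x i j t := by
  have hev : ∀ᶠ s in atTop, ∀ i j, ¬ IsEngagement d₁ τ x i j s :=
    eventually_all.2 fun i => eventually_all.2 fun j =>
      hx.eventually_not_isEngagement hμ hd₁ hδmin hspeed hτ i j
  obtain ⟨T, hT0, hT⟩ :=
    ((eventually_ge_atTop (0 : ℝ)).and (eventually_forall_ge_atTop.2 hev)).exists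
  refine ⟨T + 2 * δmax, fun i t ht => ?_, fun i j t ht => ?_⟩ <;> have hδmax := hτ.max_nonneg i
  · have hweight : ∀ u ∈ uIoc (T + 2 * δmax) t, ∀ j, weight d₀ d₁ δmin δmax τ x i j u = 0 := by
      intro u hu j
      rw [uIoc_of_le ht] at hu
      by_contra hne
      obtain ⟨s, hs, h⟩ := exists_isEngagement_of_weight_ne_zero hτ hne
      exact hT s (by linarith [hs.1, hu.1]) i j h
    rw [← sub_eq_zero, hx.sub_eq i (by linarith) ht]
    refine intervalIntegral.integral_zero_ae (Eventually.of_forall fun u hu => ?_)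
    simp [velocity, hweight u hu, sat_eq_smul]
  · exact hT t (by linarith) i j

end IsTrajectory

end Trajectory

end MobileRobots

theorem proposition2 (n : ℕ) [NeZero n] (μ d₀ d₁ δmin δmax : ℝ)
    (hμ : 0 < μ) (hd₀ : 0 < d₀) (hd : d₀ < d₁) (hδmin : 0 < δmin) (hδ : δmin < δmax)
    (hspeed : 4 * δmax * μ ≤ d₁ - d₀)
    (τ : Fin n → ℕ → ℝ) (hτ : MobileRobots.IsWakeUpSchedule δmin δmax τ)
    (x : Fin n → ℝ → MobileRobots.Plane)
    (hx : MobileRobots.IsTrajectory μ d₀ d₁ δmin δmax τ x) :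
    (∀ i, ∃ p : MobileRobots.Plane, Tendsto (x i) atTop (𝓝 p)) ∧
      ∃ L : ℝ, Tendsto (MobileRobots.groupDiam x) atTop (𝓝 L) ∧ L ≤ d₁ := by
  obtain ⟨T, hT, hno⟩ := hx.exists_forall_eq hμ (hd₀.trans hd) hδmin hspeed hτ
  refine ⟨fun i => ⟨x i T, tendsto_atTop_of_eventually_const (hT i)⟩,
    MobileRobots.groupDiam x T,
    tendsto_atTop_of_eventually_const (i₀ := T) fun t ht => ?_, ?_⟩
  · simp only [MobileRobots.groupDiam, hT _ t ht]
  · refine Finset.sup'_le _ _ fun p _ => ?_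
    obtain ⟨k, hk⟩ := hτ.exists_ge hδmin p.1 T
    rw [← hT p.1 _ hk, ← hT p.2 _ hk]
    by_contra! hlt
    exact hno p.1 p.2 _ hk ⟨Or.inl ⟨k, rfl⟩, hlt.le⟩
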